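/- All graphs are finite, simple and undirected. A two-rooted graph is a triple $(H,s,t)$, where $H$ is a graph and $s,t$ are two (not necessarily distinct) vertices of $H$, named so that $d_H(s)\le d_H(t)$. For a set $X$ of vertices of a graph $G$, $N_G[X]$ denotes $X$ together with all vertices having a neighbor in $X$. A copy of $(\hat H,\hat s,\hat t)$ in a graph $G$ is a triple $(H,s,t)$ such that $H$ is an induced subgraph of $G$ and some isomorphism from $\hat H$ to $H$ maps $\hat s$ to $s$ and $\hat t$ to $t$. An extension of such a copy in $G$ is a triple $(H',s',t')$ such that $s',t'$ are two distinct vertices of $G$ outside $V(H)$, $H'$ is the subgraph of $G$ induced by $V(H)\cup\{s',t'\}$, the only neighbor of $s'$ in $H'$ is $s$, and the only neighbor of $t'$ in $H'$ is $t$. The extension is closable if $G$ contains an induced $s',t'$-path having no vertex in common with $N_G[V(H)]$ except $s'$ and $t'$. The copy $(H,s,t)$ is avoidable in $G$ if all its extensions in $G$ are closable. The two-rooted graph $(\hat H,\hat s,\hat t)$ is inherent if every graph $G$ that contains an induced subgraph isomorphic to $\hat H$ contains an avoidable copy of $(\hat H,\hat s,\hat t)$. Theorem. Let $(H,s,t)$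 be an inherent two-rooted graph such that $H$ is connected (and $d_H(s)\le d_H(t)$). Then $(H,s,t)$ is a subcubic two-rooted tree, that is, either $H$ is a path (possibly with a single vertex) and $s$ is an endpoint of it, or $H$ is a tree of maximum degree exactly $3$ such that $1=d_H(s)\le d_H(t)\le 2$, where $d_H(t)=1$ if and only if $s=t$. -/

import Mathlib

namespace TwoRooted

universe u v

variable {V : Type u} {W : Type v}

/-- The closed neighborhood `N_G[X]`. -/
def closedNbhd (G : SimpleGraph W) (X : Set W) : Set W :=
  {w | w ∈ X ∨ ∃ x ∈ X, G.Adj x w}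

/-- The triple `(G[S], a, b)` is a copy of the two-rooted graph `(H, s, t)` in `G`
(an induced subgraph is given by its vertex set). -/
def IsCopy (H : SimpleGraph V) (s t : V) (G : SimpleGraph W) (S : Set W) (a b : W) : Prop :=
  ∃ φ : H ≃g G.induce S, (φ s : W) = a ∧ (φ t : W) = b

/-- The triple `(G[S ∪ {a', b'}], a', b')` is an extension of `(G[S], a, b)` in `G`: it arises
from `G[S]` by adding the two pendant edges `a a'` and `b b'`. -/
def IsExtension (G : SimpleGraph W) (S : Set W) (a b a' b' : W) : Prop :=
  a' ∉ S ∧ b' ∉ S ∧ a' ≠ b' ∧ ¬ G.Adj a' b' ∧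
    (∀ x ∈ S, G.Adj a' x ↔ x = a) ∧ (∀ x ∈ S, G.Adj b' x ↔ x = b)

/-- The extension of `G[S]` with new vertices `a'` and `b'` is closable: some induced
`a', b'`-path of `G` avoids `N_G[S]` except at its two ends. -/
def IsClosable (G : SimpleGraph W) (S : Set W) (a' b' : W) : Prop :=
  ∃ p : G.Walk a' b', p.IsPath ∧ p.toSubgraph.IsInduced ∧
    ∀ x ∈ p.support, x ∈ closedNbhd G S → x = a' ∨ x = b'

/-- The copy `(G[S], a, b)` is avoidable in `G`: all of its extensions are closable. -/
def IsAvoidable (G : SimpleGraph W) (S : Set W) (a b : W) : Prop :=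
  ∀ a' b' : W, IsExtension G S a b a' b' → IsClosable G S a' b'

/-- `(H, s, t)` is inherent: every finite graph `G` containing a copy of `H` (as an induced
subgraph) contains an avoidable copy of `(H, s, t)`. As `G` is finite, the universe that its
vertex type lives in is immaterial. -/
def IsInherent (H : SimpleGraph V) (s t : V) : Prop :=
  ∀ (W : Type u) [Finite W] (G : SimpleGraph W), H.IsIndContained G →
    ∃ (S : Set W) (a b : W), IsCopy H s t G S a b ∧ IsAvoidable G S a b

/-- `H` is a path (with at least one vertex) and `s` is one of its endpoints. By reversing the
path, the endpoint can always be taken to be its first vertex. -/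
def IsPathWithEndpoint (H : SimpleGraph V) (s : V) : Prop :=
  ∃ (l : ℕ) (φ : SimpleGraph.pathGraph (l + 1) ≃g H), φ 0 = s

/-- `(H, s, t)` is a subcubic two-rooted tree. -/
def IsSubcubicTwoRootedTree [Fintype V] (H : SimpleGraph V) [DecidableRel H.Adj]
    (s t : V) : Prop :=
  IsPathWithEndpoint H s ∨
    (H.IsTree ∧ H.maxDegree = 3 ∧
      1 = H.degree s ∧ H.degree s ≤ H.degree t ∧ H.degree t ≤ 2 ∧
      (H.degree t = 1 ↔ s = t))

end TwoRooted

/-! Attach trees to the vertices of `H`, the node `w` over `v` getting `k v w` children, down to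
depth `|V|`. This host contains `H`, hence an avoidable copy, and three choices of `k` give all
constraints. With a large constant `k`, a copy with both roots above the last level has a
non-closable extension by fresh children, so some root lies on the last level. There it is a leaf,
so `d(s) ≤ 1`; and `H` is acyclic, since a cycle would make the copy meet the base `H` and stay
shallow. From then on the host is acyclic, and distinct neighbors of the two roots outside the copy
already refute avoidability, so counting neighbors suffices. With `pathChildren`, a branching vertex
must land in the base, and distinct roots have spare neighbors unless `d(t) = 2`. This yields `d(t)
≤ 2`. With `k = 2`, a vertex of degree at least 4 must land in the base, and both roots again have
spare neighbors. -/

namespace TwoRooted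

/-! ### Non-avoidable copies in acyclic graphs -/

section Avoidability

variable {V : Type*} {W : Type*} {G : SimpleGraph W} {H : SimpleGraph V}

/-- An inherent two-rooted graph has an avoidable copy, described as an embedding, in every finite
graph containing it. -/
theorem IsInherent.exists_embedding {V W : Type u} {H : SimpleGraph V} {G : SimpleGraph W}
    {s t : V} (h : IsInherent H s t) [Finite W] (hG : H.IsIndContained G) :
    ∃ φ : H ↪g G, IsAvoidable G (Set.range φ) (φ s) (φ t) := by
  obtain ⟨S, a, b, ⟨φ, rfl, rfl⟩, hS⟩ := h W G hG
  refine ⟨(SimpleGraph.Embedding.induce S).comp φ.toEmbedding, ?_⟩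
  have hr : Set.range ((SimpleGraph.Embedding.induce S).comp φ.toEmbedding) = S := by
    ext x
    constructor
    · rintro ⟨v, rfl⟩
      exact (φ v).2
    · intro hx
      exact ⟨φ.symm ⟨x, hx⟩, by simp [SimpleGraph.Embedding.induce]⟩
  rw [hr]
  exact hS

/-- In an acyclic graph, an edge from a vertex outside a connected set `S` to `S` lies on every walk
from that vertex to `S`. -/
theorem mem_edges_of_isAcyclic (hG : G.IsAcyclic) {S : Set W} (hS : (G.induce S).Preconnected)
    {c a b : W} (hc : c ∉ S) (ha : a ∈ S) (hb : b ∈ S) (hca : G.Adj c a) (q : G.Walk c b) :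
    s(c, a) ∈ q.edges := by
  -- Closing `q` up inside `S` gives a walk from `c` to `a`, which crosses the bridge `ca`; the part
  -- inside `S` misses `c`.
  obtain ⟨r, hr⟩ : ∃ r : G.Walk b a, ∀ x ∈ r.support, x ∈ S := by
    obtain ⟨r⟩ := hS ⟨b, hb⟩ ⟨a, ha⟩
    refine ⟨r.map (SimpleGraph.Embedding.induce S).toHom, fun x hx ↦ ?_⟩
    obtain ⟨y, -, rfl⟩ := List.mem_map.1 (SimpleGraph.Walk.support_map _ r ▸ hx)
    exact y.2
  have hbr := SimpleGraph.isAcyclic_iff_forall_adj_isBridge.1 hG hca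
  have hmem := SimpleGraph.isBridge_iff_forall_walk_mem_edges.1 hbr (q.append r)
  rw [SimpleGraph.Walk.edges_append, List.mem_append] at hmem
  exact hmem.resolve_right fun h ↦ hc (hr _ (SimpleGraph.Walk.fst_mem_support_of_mem_edges _ h))

theorem eq_of_adj_of_isAcyclic (hG : G.IsAcyclic) {S : Set W} (hS : (G.induce S).Preconnected)
    {c a b : W} (hc : c ∉ S) (ha : a ∈ S) (hb : b ∈ S) (hca : G.Adj c a) (hcb : G.Adj c b) :
    a = b := by
  have := mem_edges_of_isAcyclic hG hS hc ha hb hca (.cons hcb .nil)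
  simp only [SimpleGraph.Walk.edges_cons, SimpleGraph.Walk.edges_nil, List.mem_singleton,
    Sym2.eq_iff] at this
  rcases this with ⟨-, h⟩ | ⟨h, -⟩
  · exact h
  · exact absurd (h ▸ hb) hc

/-- In an acyclic graph, two distinct neighbors of a connected set always form an extension, which
is never closable. -/
theorem not_isAvoidable_of_adj (hG : G.IsAcyclic) {S : Set W} (hS : (G.induce S).Preconnected)
    {a b a' b' : W} (ha : a ∈ S) (hb : b ∈ S) (ha' : a' ∉ S) (hb' : b' ∉ S) (hne : a' ≠ b')
    (haa : G.Adj a' a) (hbb : G.Adj b' b) : ¬ IsAvoidable G S a b := by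
  intro h
  have hab : a ≠ b' := fun h ↦ hb' (h ▸ ha)
  have hba : b ≠ a' := fun h ↦ ha' (h ▸ hb)
  have hext : IsExtension G S a b a' b' := by
    refine ⟨ha', hb', hne, ?_, ?_, ?_⟩
    · intro hadj
      have := mem_edges_of_isAcyclic hG hS ha' ha hb haa (.cons hadj (.cons hbb .nil))
      simp only [SimpleGraph.Walk.edges_cons, SimpleGraph.Walk.edges_nil, List.mem_cons,
        Sym2.eq_iff, List.not_mem_nil, or_false] at this
      grind
    · exact fun x hx ↦ ⟨fun hadj ↦ eq_of_adj_of_isAcyclic hG hS ha' hx ha hadj haa,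
        fun h ↦ h ▸ haa⟩
    · exact fun x hx ↦ ⟨fun hadj ↦ eq_of_adj_of_isAcyclic hG hS hb' hx hb hadj hbb,
        fun h ↦ h ▸ hbb⟩
  obtain ⟨p, -, -, hp⟩ := h a' b' hext
  have := mem_edges_of_isAcyclic hG hS ha' ha hb haa (p.concat hbb)
  rw [SimpleGraph.Walk.edges_concat, List.concat_eq_append, List.mem_append] at this
  rcases this with h1 | h1
  · rcases hp a (SimpleGraph.Walk.snd_mem_support_of_mem_edges _ h1) (Or.inl ha) with rfl | rfl
    · exact ha' ha
    · exact hb' ha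
  · simp only [List.mem_singleton, Sym2.eq_iff] at h1
    grind

theorem preconnected_induce_range (φ : H ↪g G) (hH : H.Connected) :
    (G.induce (Set.range φ)).Preconnected := by
  rintro ⟨_, u, rfl⟩ ⟨_, v, rfl⟩
  exact (hH.preconnected u v).map
    (⟨fun v ↦ ⟨φ v, v, rfl⟩, fun h ↦ φ.map_adj_iff.2 h⟩ : H →g G.induce (Set.range φ))

open Classical in
/-- The neighbors of `φ v` outside an induced copy of `H`. -/
theorem card_le_card_free [Fintype V] [DecidableRel H.Adj] (φ : H ↪g G) {v : V} {N : Finset W}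
    (hN : ∀ x ∈ N, G.Adj (φ v) x) :
    N.card ≤ {x ∈ N | x ∉ Set.range φ}.card + H.degree v := by
  rw [← Finset.card_filter_add_card_filter_not (s := N) (fun x ↦ x ∉ Set.range φ),
    ← H.card_neighborFinset_eq_degree, ← Finset.card_image_of_injective _ φ.injective]
  refine Nat.add_le_add_left (Finset.card_le_card fun x hx ↦ ?_) _
  obtain ⟨hx, hx'⟩ := Finset.mem_filter.1 hx
  obtain ⟨w, rfl⟩ := not_not.1 hx'
  exact Finset.mem_image_of_mem _
    ((H.mem_neighborFinset v w).2 (φ.map_adj_iff.1 (hN _ hx)))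

/-- In an acyclic graph, a copy of a connected two-rooted graph whose roots have sufficiently many
neighbors is not avoidable. -/
theorem not_isAvoidable_of_card_lt [Fintype V] [DecidableRel H.Adj] (hG : G.IsAcyclic)
    (hH : H.Connected) (φ : H ↪g G) {s t : V} {M N : Finset W}
    (hM : ∀ x ∈ M, G.Adj (φ s) x) (hN : ∀ x ∈ N, G.Adj (φ t) x)
    (hs : H.degree s < M.card) (ht : H.degree t < N.card)
    (hst : s = t → H.degree s + 1 < M.card) :
    ¬ IsAvoidable G (Set.range φ) (φ s) (φ t) := by
  classical
  have hS := preconnected_induce_range φ hH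
  have hM' := card_le_card_free φ hM
  have hN' := card_le_card_free φ hN
  by_cases h : s = t
  · have h1 := hst h
    subst h
    obtain ⟨a', ha', b', hb', hne⟩ := Finset.one_lt_card.1
      (show 1 < {x ∈ M | x ∉ Set.range φ}.card by lia)
    rw [Finset.mem_filter] at ha' hb'
    exact not_isAvoidable_of_adj hG hS ⟨s, rfl⟩ ⟨s, rfl⟩ ha'.2 hb'.2 hne
      (hM _ ha'.1).symm (hM _ hb'.1).symm
  · obtain ⟨a', ha'⟩ := Finset.card_pos.1 (show 0 < {x ∈ M | x ∉ Set.range φ}.card by lia)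
    obtain ⟨b', hb'⟩ := Finset.card_pos.1 (show 0 < {x ∈ N | x ∉ Set.range φ}.card by lia)
    rw [Finset.mem_filter] at ha' hb'
    refine not_isAvoidable_of_adj hG hS ⟨s, rfl⟩ ⟨t, rfl⟩ ha'.2 hb'.2 ?_
      (hM _ ha'.1).symm (hN _ hb'.1).symm
    rintro rfl
    exact h (φ.injective (eq_of_adj_of_isAcyclic hG hS ha'.2 ⟨s, rfl⟩ ⟨t, rfl⟩
      (hM _ ha'.1).symm (hN _ hb'.1).symm))

end Avoidability

/-! ### Connected graphs of maximum degree at most two -/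

section Path

theorem exists_adj_dist_eq {V : Type*} {H : SimpleGraph V} (hH : H.Connected) {s v : V} {n : ℕ}
    (h : H.dist s v = n + 1) :
    ∃ u, H.Adj u v ∧ H.dist s u = n := by
  obtain ⟨p, hp⟩ := hH.exists_walk_length_eq_dist v s
  rw [SimpleGraph.dist_comm, h] at hp
  cases p with
  | nil => simp at hp
  | @cons _ u _ huv q =>
    refine ⟨u, huv.symm, ?_⟩
    have h1 : q.length = n := by simpa using hp
    have h2 := SimpleGraph.dist_le q
    have h3 := hH.dist_triangle (u := s) (v := u) (w := v)
    rw [SimpleGraph.dist_eq_one_iff_adj.2 huv.symm, h] at h3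
    rw [SimpleGraph.dist_comm] at h2
    lia

variable {V : Type*} [Fintype V] {H : SimpleGraph V} [DecidableRel H.Adj]

/-- By induction, two vertices at equal distance have the same predecessor. It would have too many
neighbors: two if it is `s`, otherwise three, counting its own predecessor. -/
theorem dist_injective (hH : H.Connected) {s : V} (hs : H.degree s ≤ 1)
    (hdeg : ∀ v, H.degree v ≤ 2) : Function.Injective (H.dist s) := by
  classical
  suffices ∀ n u v, H.dist s u = n → H.dist s v = n → u = v from
    fun u v h ↦ this _ u v rfl h.symm
  intro n
  induction n with
  | zero =>
    intro u v hu hv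
    rw [hH.dist_eq_zero_iff] at hu hv
    exact hu ▸ hv
  | succ n ih =>
    intro u v hu hv
    obtain ⟨x, hxu, hx⟩ := exists_adj_dist_eq hH hu
    obtain ⟨y, hyv, hy⟩ := exists_adj_dist_eq hH hv
    obtain rfl := ih x y hx hy
    by_contra hne
    cases n with
    | zero =>
      rw [hH.dist_eq_zero_iff] at hx
      subst hx
      have : ({u, v} : Finset V) ⊆ H.neighborFinset s := by
        intro w hw
        simp only [Finset.mem_insert, Finset.mem_singleton] at hw
        rcases hw with rfl | rfl <;> simpa
      have := Finset.card_le_card this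
      rw [Finset.card_pair hne, H.card_neighborFinset_eq_degree] at this
      lia
    | succ n =>
      obtain ⟨z, hzx, hz⟩ := exists_adj_dist_eq hH hx
      have : ({z, u, v} : Finset V) ⊆ H.neighborFinset x := by
        intro w hw
        simp only [Finset.mem_insert, Finset.mem_singleton] at hw
        rcases hw with rfl | rfl | rfl
        · simpa using hzx.symm
        all_goals simpa
      have := Finset.card_le_card this
      have hzu : z ≠ u := by rintro rfl; lia
      have hzv : z ≠ v := by rintro rfl; lia
      rw [Finset.card_eq_three.2 ⟨z, u, v, hzu, hzv, hne, rfl⟩,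
        H.card_neighborFinset_eq_degree] at this
      have := hdeg x
      lia

/-- A connected graph of maximum degree at most two is a path starting at `s` if `s` has degree at
most one. -/
theorem isPathWithEndpoint_of_degree_le (hH : H.Connected) {s : V} (hs : H.degree s ≤ 1)
    (hdeg : ∀ v, H.degree v ≤ 2) : IsPathWithEndpoint H s := by
  have hinj := dist_injective hH hs hdeg
  have hlt (v : V) : H.dist s v < Fintype.card V := by
    obtain ⟨p, hp, h⟩ := hH.exists_path_of_dist s v
    exact h ▸ hp.length_lt
  have hpos : 0 < Fintype.card V := Fintype.card_pos_iff.2 ⟨s⟩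
  obtain ⟨l, hl⟩ : ∃ l, Fintype.card V = l + 1 := ⟨Fintype.card V - 1, by lia⟩
  let f : V → Fin (l + 1) := fun v ↦ ⟨H.dist s v, hl ▸ hlt v⟩
  have hf : Function.Bijective f :=
    (Fintype.bijective_iff_injective_and_card f).2
      ⟨fun u v h ↦ hinj (by simpa [f] using h), by simp [hl]⟩
  have hadj {u v : V} : (SimpleGraph.pathGraph (l + 1)).Adj (f u) (f v) ↔ H.Adj u v := by
    have key {u v : V} (h : H.dist s u + 1 = H.dist s v) : H.Adj u v := by
      obtain ⟨x, hx, hxu⟩ := exists_adj_dist_eq hH h.symm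
      exact hinj hxu ▸ hx
    rw [SimpleGraph.pathGraph_adj]
    constructor
    · rintro (h | h)
      · exact key h
      · exact (key h).symm
    · intro h
      have h1 := hH.dist_triangle (u := s) (v := u) (w := v)
      have h2 := hH.dist_triangle (u := s) (v := v) (w := u)
      rw [SimpleGraph.dist_eq_one_iff_adj.2 h] at h1
      rw [SimpleGraph.dist_eq_one_iff_adj.2 h.symm] at h2
      have h3 : H.dist s u ≠ H.dist s v := fun e ↦ h.ne (hinj e)
      change H.dist s u + 1 = H.dist s v ∨ H.dist s v + 1 = H.dist s u
      lia
  let e : H ≃g SimpleGraph.pathGraph (l + 1) := ⟨Equiv.ofBijective f hf, hadj⟩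
  refine ⟨l, e.symm, ?_⟩
  rw [RelIso.symm_apply_eq]
  ext
  exact SimpleGraph.dist_self.symm

end Path

/-! ### The host graphs: `H` with trees attached -/

section AttachTrees

variable {V : Type*} (H : SimpleGraph V) (k : V → List ℕ → ℕ)

/-- The graph obtained from `H` by attaching to each vertex a tree of infinite depth and degree.
The vertices of the tree attached to `v` are the pairs `(v, w)`, and the children of `(v, w)` are
the pairs `(v, i :: w)`. -/
def treeGrowth : SimpleGraph (V × List ℕ) where
  Adj x y := (x.2 = [] ∧ y.2 = [] ∧ H.Adj x.1 y.1) ∨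
    (x.1 = y.1 ∧ ((∃ i, x.2 = i :: y.2) ∨ ∃ i, y.2 = i :: x.2))
  symm := ⟨by
    rintro x y (⟨h1, h2, h3⟩ | ⟨h1, h2⟩)
    · exact Or.inl ⟨h2, h1, h3.symm⟩
    · exact Or.inr ⟨h1.symm, h2.symm⟩⟩
  loopless := ⟨by
    rintro x (⟨-, -, h⟩ | ⟨-, ⟨i, h⟩ | ⟨i, h⟩⟩)
    · exact h.ne rfl
    · simp at h
    · simp at h⟩

variable {H}

/-- Letters are prepended, so descendants are the words with a given suffix, and the only edge
leaving them goes up to the parent. Acyclicity and non-closability both rest on this. -/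
theorem exit_descendants {v : V} {w : List ℕ} {i : ℕ} {x y : V × List ℕ}
    (hadj : (treeGrowth H).Adj x y) (hx : x.1 = v ∧ i :: w <:+ x.2)
    (hy : ¬ (y.1 = v ∧ i :: w <:+ y.2)) : x = (v, i :: w) ∧ y = (v, w) := by
  obtain ⟨x1, x2⟩ := x
  obtain ⟨y1, y2⟩ := y
  obtain ⟨rfl, hx⟩ := hx
  rcases hadj with ⟨h1, h2, -⟩ | ⟨h1, ⟨j, h2⟩ | ⟨j, h2⟩⟩
  · simp only at h1
    simp [h1] at hx
  · simp only at h1 h2 hx hy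
    subst h1 h2
    rw [List.suffix_cons_iff] at hx
    rcases hx with hx | hx
    · simp only [List.cons.injEq] at hx
      simp [hx]
    · exact absurd ⟨rfl, hx⟩ hy
  · simp only at h1 h2 hx hy
    subst h1 h2
    exact absurd ⟨rfl, hx.trans (List.suffix_cons _ _)⟩ hy

theorem mem_edges_of_child {v : V} {w : List ℕ} {i : ℕ}
    (p : (treeGrowth H).Walk (v, i :: w) (v, w)) : s((v, i :: w), (v, w)) ∈ p.edges := by
  obtain ⟨d, hd, h1, h2⟩ := p.exists_boundary_dart {x | x.1 = v ∧ i :: w <:+ x.2}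
    ⟨rfl, List.suffix_rfl⟩ (fun h ↦ by simpa using h.2.length_le)
  obtain ⟨e1, e2⟩ := exit_descendants d.adj h1 h2
  have : d.edge ∈ p.edges := List.mem_map_of_mem hd
  rwa [SimpleGraph.Dart.edge, ← Prod.mk.eta (p := d.toProd), e1, e2] at this

theorem treeGrowth_isAcyclic (hH : H.IsAcyclic) : (treeGrowth H).IsAcyclic := by
  rw [SimpleGraph.isAcyclic_iff_forall_adj_isBridge]
  rintro ⟨v, w⟩ ⟨u, w'⟩ hadj
  rw [SimpleGraph.isBridge_iff_forall_walk_mem_edges]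
  intro p
  rcases hadj with ⟨h1, h2, h3⟩ | ⟨h1, ⟨j, h2⟩ | ⟨j, h2⟩⟩
  · simp only at h1 h2 h3
    subst h1 h2
    have hb := SimpleGraph.isAcyclic_iff_forall_adj_isBridge.1 hH h3
    rw [SimpleGraph.isBridge_iff] at hb
    -- Tree edges keep the first coordinate, so a walk can leave the component of `v` in `H` minus
    -- `vu` only along the base edge `vu`.
    obtain ⟨d, hd, h1, h2⟩ := p.exists_boundary_dart
      {x | (H.deleteEdges {s(v, u)}).Reachable v x.1} (SimpleGraph.Reachable.refl _) hb
    have : d.edge ∈ p.edges := List.mem_map_of_mem hd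
    rcases d.adj with ⟨h4, h5, h6⟩ | ⟨h4, -⟩
    · by_cases he : s(d.fst.1, d.snd.1) = s(v, u)
      · convert this using 1
        have h7 : d.edge = Sym2.map (fun x ↦ (x, [])) s(d.fst.1, d.snd.1) := by
          rw [Sym2.map_mk, ← h4, Prod.mk.eta, h4, ← h5, Prod.mk.eta]
          rfl
        rw [h7, he, Sym2.map_mk]
      · refine absurd (SimpleGraph.Reachable.trans h1 (SimpleGraph.Adj.reachable ?_)) h2
        rw [SimpleGraph.deleteEdges_adj]
        exact ⟨h6, he⟩
    · refine absurd (show (H.deleteEdges {s(v, u)}).Reachable v d.snd.1 from ?_) h2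
      exact h4 ▸ h1
  · simp only at h1 h2
    subst h1 h2
    exact mem_edges_of_child p
  · simp only at h1 h2
    subst h1 h2
    rw [Sym2.eq_swap, ← List.mem_reverse, ← SimpleGraph.Walk.edges_reverse]
    exact mem_edges_of_child p.reverse

/-- The words all of whose letters obey the bounds `k` on the numbers of children. -/
def IsAdmissible (v : V) : List ℕ → Prop
  | [] => True
  | i :: w => IsAdmissible v w ∧ i < k v w

/-- The vertices of `attachTrees H k`. -/
abbrev Node : Type _ := {x : V × List ℕ // IsAdmissible k x.1 x.2}

variable (H) in
/-- The graph obtained from `H` by attaching to each vertex `v` a tree in which the node `w` has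
`k v w` children. -/
def attachTrees : SimpleGraph (Node k) :=
  (treeGrowth H).comap Subtype.val

theorem attachTrees_isAcyclic (hH : H.IsAcyclic) : (attachTrees H k).IsAcyclic :=
  (treeGrowth_isAcyclic hH).comap (SimpleGraph.Hom.comap Subtype.val _) Subtype.val_injective

theorem isIndContained_attachTrees : H.IsIndContained (attachTrees H k) :=
  ⟨⟨⟨fun v ↦ ⟨(v, []), trivial⟩, fun _ _ h ↦ congrArg (fun x : Node k ↦ x.1.1) h⟩,
    ⟨fun h ↦ h.elim (fun h ↦ h.2.2) (fun h ↦ by simp at h), fun h ↦ Or.inl ⟨rfl, rfl, h⟩⟩⟩⟩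

variable {k}

theorem length_le_of_isAdmissible {L : ℕ} (hL : ∀ v w, L ≤ w.length → k v w = 0) {v : V} :
    ∀ {w : List ℕ}, IsAdmissible k v w → w.length ≤ L
  | [], _ => by simp
  | i :: w, h => by
    by_contra hlt
    have := h.2
    rw [hL v w (by simpa using hlt)] at this
    lia

theorem finite_isAdmissible [Finite V] {D L : ℕ} (hD : ∀ v w, k v w ≤ D)
    (hL : ∀ v w, L ≤ w.length → k v w = 0) :
    Finite (Node k) := by
  have key (n : ℕ) : {w : List ℕ | w.length ≤ n ∧ ∀ i ∈ w, i < D}.Finite := by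
    induction n with
    | zero =>
      refine (Set.finite_singleton []).subset ?_
      rintro w ⟨h, -⟩
      simpa using h
    | succ n ih =>
      refine ((Set.finite_singleton []).union
        (Set.Finite.image2 List.cons (Set.finite_lt_nat D) ih)).subset ?_
      rintro (_ | ⟨i, w⟩) ⟨h1, h2⟩
      · exact Or.inl rfl
      · exact Or.inr ⟨i, h2 i (by simp), w, ⟨by simpa using h1, fun j hj ↦ h2 j (by simp [hj])⟩, rfl⟩
  have hlt {v : V} : ∀ {w : List ℕ}, IsAdmissible k v w → ∀ i ∈ w, i < D := by
    intro w
    induction w with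
    | nil => simp
    | cons j w ih =>
      rintro ⟨h1, h2⟩ i hi
      rcases List.mem_cons.1 hi with rfl | hi
      · exact h2.trans_le (hD _ _)
      · exact ih h1 i hi
  refine Set.Finite.to_subtype (s := {x : V × List ℕ | IsAdmissible k x.1 x.2})
    ((Set.finite_univ.prod (key L)).subset ?_)
  rintro ⟨v, w⟩ h
  exact ⟨trivial, length_le_of_isAdmissible hL h, hlt h⟩

variable (k) in
/-- The children of a vertex of `attachTrees H k`. -/
def child (x : Node k) (i : ℕ) (hi : i < k x.1.1 x.1.2) :
    Node k :=
  ⟨(x.1.1, i :: x.1.2), x.2, hi⟩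

theorem adj_child (x : Node k) (i : ℕ)
    (hi : i < k x.1.1 x.1.2) : (attachTrees H k).Adj x (child k x i hi) :=
  Or.inr ⟨rfl, Or.inr ⟨i, rfl⟩⟩

theorem exists_children (x : Node k) :
    ∃ N : Finset (Node k),
      (∀ y ∈ N, (attachTrees H k).Adj x y ∧ y.1.2.length = x.1.2.length + 1) ∧
        N.card = k x.1.1 x.1.2 := by
  refine ⟨Finset.univ.map ⟨fun i : Fin (k x.1.1 x.1.2) ↦ child k x i i.2, fun i j h ↦ ?_⟩, ?_, ?_⟩
  · have : i.1 :: x.1.2 = j.1 :: x.1.2 := congrArg (fun x : Node k ↦ x.1.2) h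
    exact Fin.ext (List.cons.inj this).1
  · intro y hy
    obtain ⟨i, -, rfl⟩ := Finset.mem_map.1 hy
    exact ⟨adj_child x i i.2, rfl⟩
  · simp

theorem exists_neighbors_of_adj {x y : Node k}
    (hxy : (attachTrees H k).Adj x y) (h : y.1.2.length ≤ x.1.2.length) :
    ∃ N : Finset (Node k),
      (∀ y ∈ N, (attachTrees H k).Adj x y) ∧ N.card = k x.1.1 x.1.2 + 1 := by
  obtain ⟨N, hN, hc⟩ := exists_children (H := H) x
  refine ⟨N.cons y fun hy ↦ ?_, fun z hz ↦ ?_, ?_⟩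
  · have := (hN y hy).2
    lia
  · rcases Finset.mem_cons.1 hz with rfl | hz
    · exact hxy
    · exact (hN z hz).1
  · rw [Finset.card_cons, hc]

/-- If `H` has no isolated vertices, every vertex of `attachTrees H k` has a neighbor that is not
one of its children. -/
theorem exists_neighbors (hH : ∀ v, ∃ u, H.Adj v u)
    (x : Node k) :
    ∃ N : Finset (Node k),
      (∀ y ∈ N, (attachTrees H k).Adj x y) ∧ N.card = k x.1.1 x.1.2 + 1 := by
  obtain ⟨⟨v, _ | ⟨i, w⟩⟩, hx⟩ := x
  · obtain ⟨u, hu⟩ := hH v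
    exact exists_neighbors_of_adj (y := ⟨(u, []), trivial⟩) (Or.inl ⟨rfl, rfl, hu⟩) le_rfl
  · exact exists_neighbors_of_adj (y := ⟨(v, w), hx.1⟩) (Or.inr ⟨rfl, Or.inl ⟨i, rfl⟩⟩) (by simp)

/-! ### Degrees and depths of copies of `H` -/

section Embedding

variable [Fintype V] [DecidableRel H.Adj] (φ : H ↪g attachTrees H k)

open Classical in
theorem degree_le_card {v : V} {N : Finset (V × List ℕ)}
    (hN : ∀ y, (treeGrowth H).Adj (φ v).1 y → IsAdmissible k y.1 y.2 → y ∈ N) :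
    H.degree v ≤ N.card := by
  rw [← H.card_neighborFinset_eq_degree]
  refine Finset.card_le_card_of_injOn (fun u ↦ (φ u).1) (fun u hu ↦ ?_)
    (fun u _ u' _ h ↦ φ.injective (Subtype.ext h))
  exact hN _ (φ.map_adj_iff.2 ((H.mem_neighborFinset v u).1 hu)) (φ u).2

/-- The degrees in the attached trees, including the parent. -/
theorem degree_le_of_ne_nil {v : V} (hv : (φ v).1.2 ≠ []) :
    H.degree v ≤ k (φ v).1.1 (φ v).1.2 + 1 := by
  classical
  generalize hx : (φ v).1 = x at *
  obtain ⟨u, _ | ⟨i, w⟩⟩ := x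
  · exact absurd rfl hv
  refine (degree_le_card φ (N := insert (u, w)
    ((Finset.range (k u (i :: w))).image fun j ↦ (u, j :: i :: w))) ?_).trans
    ((Finset.card_insert_le _ _).trans (Nat.add_le_add_right
      (Finset.card_image_le.trans_eq (Finset.card_range _)) 1))
  rintro ⟨y1, y2⟩ hadj hy
  rw [hx] at hadj
  rcases hadj with ⟨h, -⟩ | ⟨rfl, ⟨j, h⟩ | ⟨j, h⟩⟩
  · simp at h
  · simp only [List.cons.injEq] at h
    simp [h]
  · simp only at h
    subst h
    simp [hy.2]

theorem degree_le_of_eq_nil {v : V} (hv : (φ v).1.2 = []) :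
    H.degree v ≤ k (φ v).1.1 [] + H.degree (φ v).1.1 := by
  classical
  generalize hx : (φ v).1 = x at *
  obtain ⟨u, w⟩ := x
  simp only at hv ⊢
  subst hv
  refine (degree_le_card φ (N := ((Finset.range (k u [])).image fun j ↦ (u, [j])) ∪
    (H.neighborFinset u).image fun v ↦ (v, [])) ?_).trans
    ((Finset.card_union_le _ _).trans (Nat.add_le_add
      (Finset.card_image_le.trans_eq (Finset.card_range _))
      (Finset.card_image_le.trans_eq (H.card_neighborFinset_eq_degree u))))
  rintro ⟨y1, y2⟩ hadj hy
  rw [hx] at hadj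
  rcases hadj with ⟨-, h, h'⟩ | ⟨rfl, ⟨j, h⟩ | ⟨j, h⟩⟩
  · simp only at h h'
    subst h
    simp [h']
  · simp at h
  · simp only at h
    subst h
    simp [hy.2]

omit [DecidableRel H.Adj] in
/-- A copy of a connected graph `H` that meets `H` does not reach the depth `|V(H)|`. -/
theorem length_lt_card (hH : H.Connected) {u : V} (hu : (φ u).1.2 = []) (v : V) :
    (φ v).1.2.length < Fintype.card V := by
  have key {v : V} (p : H.Walk u v) : (φ v).1.2.length ≤ p.length := by
    -- Each edge raises the depth by at most one.
    suffices ∀ {a b : V} (p : H.Walk a b), (φ b).1.2.length ≤ (φ a).1.2.length + p.length by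
      simpa [hu] using this p
    intro a b p
    induction p with
    | nil => simp
    | @cons a c b hac p ih =>
      have h : (treeGrowth H).Adj (φ a).1 (φ c).1 := φ.map_adj_iff.2 hac
      have : (φ c).1.2.length ≤ (φ a).1.2.length + 1 := by
        rcases h with ⟨-, h, -⟩ | ⟨-, ⟨j, h⟩ | ⟨j, h⟩⟩ <;> (simp [h]; try lia)
      rw [SimpleGraph.Walk.length_cons]
      lia
  obtain ⟨p, hp⟩ := hH.exists_isPath u v
  exact (key p).trans_lt hp.length_lt

end Embedding

/-- A copy all of whose vertices lie in the attached trees is acyclic. -/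
theorem isAcyclic_of_forall_ne_nil (φ : H ↪g attachTrees H k) (h : ∀ v, (φ v).1.2 ≠ []) :
    H.IsAcyclic := by
  -- Away from the base no edge of `H` is used, so the copy also lies in the growth of the edgeless
  -- graph.
  have hbot : (⊥ : SimpleGraph V).IsAcyclic := SimpleGraph.isAcyclic_bot
  refine (treeGrowth_isAcyclic hbot).comap (⟨fun v ↦ (φ v).1, fun {u v} huv ↦ ?_⟩)
    (Subtype.val_injective.comp φ.injective)
  rcases (φ.map_adj_iff.2 huv : (treeGrowth H).Adj (φ u).1 (φ v).1) with ⟨h1, -⟩ | h1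
  · exact absurd h1 (h u)
  · exact Or.inr h1

/-- If every vertex has sufficiently many children, the copies avoiding the leaves of the attached
trees are not avoidable. -/
theorem not_isAvoidable_of_fresh (φ : H ↪g attachTrees H k) {s t : V} {i j : ℕ} (hij : i ≠ j)
    (hi : ∀ v, i ∉ (φ v).1.2) (hj : ∀ v, j ∉ (φ v).1.2)
    (his : i < k (φ s).1.1 (φ s).1.2) (hjt : j < k (φ t).1.1 (φ t).1.2) :
    ¬ IsAvoidable (attachTrees H k) (Set.range φ) (φ s) (φ t) := by
  have hnot {r : V} {l : ℕ} (hr : l < k (φ r).1.1 (φ r).1.2) (hl : ∀ v, l ∉ (φ v).1.2) :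
      child k (φ r) l hr ∉ Set.range φ := by
    rintro ⟨v, hv⟩
    exact hl v (by rw [hv]; simp [child])
  have huniq {r : V} {l : ℕ} (hr : l < k (φ r).1.1 (φ r).1.2) (hl : ∀ v, l ∉ (φ v).1.2) :
      ∀ x ∈ Set.range φ, (attachTrees H k).Adj (child k (φ r) l hr) x ↔ x = φ r := by
    rintro _ ⟨v, rfl⟩
    constructor
    · rintro (⟨h, -⟩ | ⟨h, ⟨m, h'⟩ | ⟨m, h'⟩⟩)
      · simp [child] at h
      · simp only [child, List.cons.injEq] at h h'
        exact Subtype.ext (Prod.ext h.symm h'.2.symm)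
      · exact absurd (by rw [h']; simp [child]) (hl v)
    · intro h
      rw [h]
      exact (adj_child _ _ hr).symm
  intro hav
  have hext : IsExtension (attachTrees H k) (Set.range φ) (φ s) (φ t)
      (child k (φ s) i his) (child k (φ t) j hjt) := by
    refine ⟨hnot his hi, hnot hjt hj, ?_, ?_, huniq his hi, huniq hjt hj⟩
    · intro h
      have : i :: (φ s).1.2 = j :: (φ t).1.2 := congrArg (fun x : Node k ↦ x.1.2) h
      exact hij (List.cons.inj this).1
    · rintro (⟨h, -⟩ | ⟨-, ⟨m, h⟩ | ⟨m, h⟩⟩)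
      · simp [child] at h
      · simp only [child, List.cons.injEq] at h
        exact hj s (by rw [h.2]; simp)
      · simp only [child, List.cons.injEq] at h
        exact hi t (by rw [h.2]; simp)
  obtain ⟨p, -, -, hp⟩ := hav _ _ hext
  -- To leave the descendants of the fresh child of `φ s`, the path must pass through `φ s`, which
  -- lies in the copy and is neither end.
  obtain ⟨d, hd, h1, h2⟩ := p.exists_boundary_dart
    {x | x.1.1 = (φ s).1.1 ∧ i :: (φ s).1.2 <:+ x.1.2} ⟨rfl, List.suffix_rfl⟩ (by
      rintro ⟨-, h⟩
      simp only [child] at h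
      rw [List.suffix_cons_iff] at h
      rcases h with h | h
      · simp only [List.cons.injEq] at h
        exact hij h.1
      · exact hi t (h.subset (by simp)))
  have hds : d.snd = φ s := Subtype.ext (exit_descendants (H := H) d.adj h1 h2).2
  rcases hp d.snd (p.dart_snd_mem_support_of_mem_darts hd) (Or.inl ⟨s, hds.symm⟩) with h | h
  · exact hnot his hi ⟨s, hds.symm.trans h⟩
  · exact hnot hjt hj ⟨s, hds.symm.trans h⟩

end AttachTrees

/-! ### Constraints from the three hosts -/

section Necessity

variable {V : Type u} [Fintype V] {H : SimpleGraph V} [DecidableRel H.Adj] {s t : V}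

open Classical in
omit [DecidableRel H.Adj] in
theorem IsInherent.exists_embedding_regular (hinh : IsInherent H s t) :
    ∃ (D : ℕ) (φ : H ↪g attachTrees H fun _ w ↦ if w.length < Fintype.card V then D else 0),
      Fintype.card V ≤ (φ s).1.2.length ∨ Fintype.card V ≤ (φ t).1.2.length := by
  set L := Fintype.card V with hL
  -- The `L` vertices of the copy have words of at most `L` letters, so at most `L * L` letters
  -- occur and two stay fresh.
  refine ⟨L * L + 2, ?_⟩
  have hk (v : V) (w : List ℕ) (hw : L ≤ w.length) :
      (if w.length < L then L * L + 2 else 0) = 0 := if_neg (by lia)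
  have := finite_isAdmissible (V := V) (k := fun _ w ↦ if w.length < L then L * L + 2 else 0)
    (D := L * L + 2) (fun v w ↦ by split <;> lia) hk
  obtain ⟨φ, hφ⟩ := hinh.exists_embedding (isIndContained_attachTrees (H := H)
    (k := fun _ w ↦ if w.length < L then L * L + 2 else 0))
  refine ⟨φ, ?_⟩
  by_contra! hlt
  let U : Finset ℕ := Finset.univ.biUnion fun v ↦ (φ v).1.2.toFinset
  have hU : U.card ≤ L * L := by
    refine Finset.card_biUnion_le_card_mul _ _ _ fun v _ ↦ ?_
    exact (List.toFinset_card_le _).trans (length_le_of_isAdmissible hk (φ v).2)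
  have hfree : 1 < (Finset.range (L * L + 2) \ U).card := by
    have := Finset.le_card_sdiff U (Finset.range (L * L + 2))
    rw [Finset.card_range] at this
    lia
  obtain ⟨i, hi, j, hj, hij⟩ := Finset.one_lt_card.1 hfree
  simp only [Finset.mem_sdiff, Finset.mem_range, U, Finset.mem_biUnion, Finset.mem_univ, true_and,
    List.mem_toFinset, not_exists] at hi hj
  exact not_isAvoidable_of_fresh φ hij hi.2 hj.2 (by rw [if_pos hlt.1]; exact hi.1)
    (by rw [if_pos hlt.2]; exact hj.1) hφ

omit [DecidableRel H.Adj] in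
theorem IsInherent.isAcyclic (hinh : IsInherent H s t) (hH : H.Connected) : H.IsAcyclic := by
  classical
  obtain ⟨D, φ, hφ⟩ := hinh.exists_embedding_regular
  by_contra hcyc
  obtain ⟨v, hv⟩ : ∃ v, (φ v).1.2 = [] := by
    by_contra! h
    exact hcyc (isAcyclic_of_forall_ne_nil φ h)
  have hs := length_lt_card φ hH hv s
  have ht := length_lt_card φ hH hv t
  lia

theorem IsInherent.degree_le_one (hinh : IsInherent H s t) (hdeg : H.degree s ≤ H.degree t) :
    H.degree s ≤ 1 := by
  obtain ⟨D, φ, hφ⟩ := hinh.exists_embedding_regular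
  have hpos : 0 < Fintype.card V := Fintype.card_pos_iff.2 ⟨s⟩
  have key {r : V} (hr : Fintype.card V ≤ (φ r).1.2.length) : H.degree r ≤ 1 := by
    have := degree_le_of_ne_nil φ (v := r) (by
      intro h
      rw [h] at hr
      simp only [List.length_nil] at hr
      lia)
    rwa [if_neg (by lia)] at this
  rcases hφ with h | h
  · exact key h
  · exact hdeg.trans (key h)

theorem IsInherent.degree_le_three (hinh : IsInherent H s t) (hH : H.Connected)
    (hadj : ∀ v, ∃ u, H.Adj v u) (hs : H.degree s ≤ 1) (ht : H.degree t ≤ 2) (c : V) :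
    H.degree c ≤ 3 := by
  by_contra! hc
  have := finite_isAdmissible (V := V) (D := 2) (L := Fintype.card V)
    (k := fun _ w ↦ if w.length < Fintype.card V then 2 else 0)
    (fun v w ↦ by split <;> lia) (fun v w hw ↦ if_neg (by lia))
  obtain ⟨φ, hφ⟩ := hinh.exists_embedding (isIndContained_attachTrees (H := H)
    (k := fun _ w ↦ if w.length < Fintype.card V then 2 else 0))
  have hcnil : (φ c).1.2 = [] := by
    by_contra h
    have := degree_le_of_ne_nil φ h
    -- Nodes off the base have degree at most 3: two children and a parent.
    split at this <;> lia
  have hlt := length_lt_card φ hH hcnil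
  obtain ⟨M, hM, hMc⟩ := exists_neighbors hadj (φ s)
  obtain ⟨N, hN, hNc⟩ := exists_neighbors hadj (φ t)
  rw [if_pos (hlt _)] at hMc hNc
  -- Each root has three known neighbors, more than `d(t)` and, in case `s = t`, more than `d(s) +
  -- 1`.
  exact not_isAvoidable_of_card_lt (attachTrees_isAcyclic _ (hinh.isAcyclic hH)) hH φ hM hN
    (by lia) (by lia) (fun _ ↦ by lia) hφ

variable (H) in
/-- The numbers of children for attaching one long path to each leaf of `H` and many long paths to
each branching vertex. -/
def pathChildren (v : V) (w : List ℕ) : ℕ :=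
  if w.length < Fintype.card V then
    if w = [] then
      if H.degree v ≤ 1 then 1 else if H.degree v = 2 then 0 else Fintype.card V
    else 1
  else 0

theorem exists_two_neighbors (hadj : ∀ v, ∃ u, H.Adj v u) (x : Node (pathChildren H))
    (hx : x.1.2.length < Fintype.card V) :
    ∃ N : Finset (Node (pathChildren H)),
      (∀ y ∈ N, (attachTrees H (pathChildren H)).Adj x y) ∧ 2 ≤ N.card := by
  by_cases h : x.1.2 = [] ∧ 2 ≤ H.degree x.1.1
  · refine ⟨(H.neighborFinset x.1.1).map
      ⟨fun v ↦ ⟨(v, []), trivial⟩, fun _ _ h ↦ congrArg (fun x : Node (pathChildren H) ↦ x.1.1) h⟩,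
      fun y hy ↦ ?_, ?_⟩
    · obtain ⟨v, hv, rfl⟩ := Finset.mem_map.1 hy
      exact Or.inl ⟨h.1, rfl, (H.mem_neighborFinset _ _).1 hv⟩
    · rw [Finset.card_map, H.card_neighborFinset_eq_degree]
      exact h.2
  · obtain ⟨N, hN, hc⟩ := exists_neighbors hadj x
    refine ⟨N, hN, ?_⟩
    rw [hc, pathChildren, if_pos hx]
    by_cases h' : x.1.2 = []
    · rw [if_pos h', if_pos (by grind)]
    · rw [if_neg h']

/-- A two-rooted tree with a branching vertex is not inherent if its roots are distinct, one of
them is a leaf, and the other one does not have degree two. -/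
theorem IsInherent.eq_of_branching (hinh : IsInherent H s t) (hH : H.Connected)
    (hadj : ∀ v, ∃ u, H.Adj v u) (hs : H.degree s ≤ 1) (ht : H.degree t ≠ 2) {c : V}
    (hc : 3 ≤ H.degree c) : s = t := by
  by_contra hst
  have hpos : 0 < Fintype.card V := Fintype.card_pos_iff.2 ⟨s⟩
  have := finite_isAdmissible (V := V) (D := Fintype.card V) (L := Fintype.card V)
    (k := pathChildren H) (fun v w ↦ by unfold pathChildren; split_ifs <;> lia)
    (fun v w hw ↦ if_neg (by lia))
  obtain ⟨φ, hφ⟩ := hinh.exists_embedding (isIndContained_attachTrees (H := H)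
    (k := pathChildren H))
  -- Nodes off the base have degree at most 2: one child and a parent.
  have hnil {v : V} (hv : 3 ≤ H.degree v) : (φ v).1.2 = [] := by
    by_contra h
    have := degree_le_of_ne_nil φ h
    simp only [pathChildren, if_neg h] at this
    split_ifs at this <;> lia
  have hlt := length_lt_card φ hH (hnil hc)
  obtain ⟨M, hM, hMc⟩ := exists_two_neighbors hadj (φ s) (hlt s)
  obtain ⟨N, hN, hNc⟩ : ∃ N : Finset (Node (pathChildren H)),
      (∀ y ∈ N, (attachTrees H (pathChildren H)).Adj (φ t) y) ∧ H.degree t < N.card := by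
    rcases lt_or_gt_of_ne ht with ht | ht
    · obtain ⟨N, hN, hNc⟩ := exists_two_neighbors hadj (φ t) (hlt t)
      exact ⟨N, hN, by lia⟩
    · obtain ⟨N, hN, hNc⟩ := exists_neighbors hadj (φ t)
      refine ⟨N, hN, ?_⟩
      -- A base vertex of degree at most 2 in `H` keeps degree at most 2 in the host. So `φ t` sits
      -- at a branching vertex, which has `|V| > d(t)` children.
      have h1 := hnil ht
      have h2 := degree_le_of_eq_nil φ h1
      have h3 := H.degree_lt_card_verts t
      rw [hNc, h1]
      generalize (φ t).1.1 = v at h2 ⊢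
      simp only [pathChildren, List.length_nil, hpos, if_true] at h2 ⊢
      split_ifs at h2 ⊢ <;> lia
  exact not_isAvoidable_of_card_lt (attachTrees_isAcyclic _ (hinh.isAcyclic hH)) hH φ hM hN
    (by lia) hNc (fun h ↦ absurd h hst) hφ

end Necessity

end TwoRooted

theorem mainTheorem1 {V : Type*} [Fintype V] (H : SimpleGraph V) [DecidableRel H.Adj]
    (s t : V) (hdeg : H.degree s ≤ H.degree t) (hconn : H.Connected)
    (hinh : TwoRooted.IsInherent H s t) :
    TwoRooted.IsSubcubicTwoRootedTree H s t := by
  have hs := hinh.degree_le_one hdeg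
  by_cases hbr : ∀ v, H.degree v ≤ 2
  · exact Or.inl (TwoRooted.isPathWithEndpoint_of_degree_le hconn hs hbr)
  push Not at hbr
  obtain ⟨c, hc⟩ := hbr
  have : Nontrivial V := by
    obtain ⟨u, hu⟩ := (H.degree_pos_iff_exists_adj c).1 (by lia)
    exact ⟨c, u, hu.ne⟩
  have hpos (v : V) : 0 < H.degree v := hconn.preconnected.degree_pos_of_nontrivial v
  have hadj (v : V) : ∃ u, H.Adj v u := (H.degree_pos_iff_exists_adj v).1 (hpos v)
  have hst (ht : H.degree t ≠ 2) : s = t := hinh.eq_of_branching hconn hadj hs ht hc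
  have hs1 : 1 = H.degree s := by
    have := hpos s
    lia
  have ht : H.degree t ≤ 2 := by
    by_contra! h
    have := hst (by lia)
    subst this
    lia
  have hmax : H.maxDegree = 3 :=
    le_antisymm (H.maxDegree_le_of_forall_degree_le 3
      (hinh.degree_le_three hconn hadj hs ht)) ((Nat.succ_le_of_lt hc).trans (H.degree_le_maxDegree c))
  refine Or.inr ⟨⟨hconn, hinh.isAcyclic hconn⟩, hmax, hs1, hdeg, ht, fun h ↦ hst (by lia), ?_⟩
  rintro rfl
  exact hs1.symm
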